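/- Let $q\ge 4$ be a fixed even integer. For $n\in\mathbb N$ let $c_1,\dots,c_{2n}$ be Majorana operators on the $2^n$-dimensional Fock space of $n$ fermionic modes, i.e. Hermitian operators with $c_jc_k+c_kc_j=2\delta_{jk}\mathbb I$. For $I=\{i_1<\dots<i_q\}\subseteq\{1,\dots,2n\}$ put $C_I=i^{q/2}c_{i_1}\cdots c_{i_q}$. The dense SYK-$q$ Hamiltonian is the random operator $$H=\binom{2n}{q}^{-1/2}\sum_{I\subseteq\{1,\dots,2n\},\,|I|=q}J_I\,C_I ,$$ where the $J_I$ are independent standard Gaussian random variables. A fermionic Gaussian state is an operator of the form $\rho=e^{-i\sum_{j\ne k}\beta_{jk}c_jc_k}/\mathrm{Tr}\,e^{-i\sum_{j\ne k}\beta_{jk}c_jc_k}$ with $\beta$ a real antisymmetric $2n\times 2n$ matrix, or a limit of such operators (so that pure Gaussian states are included). Then, with probability at least $1-\exp(-\Omega(n))$ over the draw of $H$, every fermionic Gaussian state $\rho$ satisfies $$|\mathrm{Tr}(H\rho)|\le (q-1)!!\;2^{1/2-q/4}\,q^{1/2+q/2}\sqrt{\log\!\big(q/\log(3/2)\big)}\;(2n)^{1-q/4};$$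 in particular $\max_{\rho\ \mathrm{Gaussian}}\mathrm{Tr}(H\rho)=O(n^{1-q/4})$. Here $1-\exp(-\Omega(n))$ means: there are $\kappa>0$ and $n_0$, depending only on $q$, such that for all $n\ge n_0$ and every choice of the Majorana operators the probability is at least $1-e^{-\kappa n}$. -/

import Mathlib

open scoped Nat

noncomputable section

namespace SYK

/-- Square complex matrices on the `2 ^ n`-dimensional Fock space of `n` fermionic modes. -/
abbrev FockOp (n : ℕ) : Type := Matrix (Fin (2 ^ n)) (Fin (2 ^ n)) ℂ

/-- `c` is a family of `2n` Majorana operators on the Fock space of `n` fermionic modes: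
Hermitian operators with `c j * c k + c k * c j = 2 δ_{jk}` (in particular `c j * c j = 1`). -/
structure IsMajorana {n : ℕ} (c : Fin (2 * n) → FockOp n) : Prop where
  isHermitian : ∀ j, (c j).IsHermitian
  anticomm : ∀ j k, c j * c k + c k * c j = if j = k then 2 else 0

/-- Majorana operators exist for every number of modes (the Jordan–Wigner construction). -/
theorem exists_isMajorana (n : ℕ) : ∃ c : Fin (2 * n) → FockOp n, IsMajorana c := by
  induction n with
  | zero => exact ⟨fun _ => 0, ⟨fun j => j.elim0, fun j => j.elim0⟩⟩
  | succ n ih =>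
    obtain ⟨c, hc⟩ := ih
    let P : Fin 2 → Matrix (Fin 2) (Fin 2) ℂ :=
      ![!![0, 1; 1, 0], !![0, -Complex.I; Complex.I, 0]]
    let Z : Matrix (Fin 2) (Fin 2) ℂ := !![1, 0; 0, -1]
    have hZ : Z * Z = 1 := by
      ext i j; fin_cases i <;> fin_cases j <;> simp [Z, Matrix.mul_apply]
    have hZh : Z.conjTranspose = Z := by
      ext i j; fin_cases i <;> fin_cases j <;> simp [Z]
    have hPh : ∀ a, (P a).conjTranspose = P a := by
      intro a; ext i j; fin_cases a <;> fin_cases i <;> fin_cases j <;> simp [P]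
    have hPZ : ∀ a, P a * Z = -(Z * P a) := by
      intro a; ext i j
      fin_cases a <;> fin_cases i <;> fin_cases j <;> simp [P, Z]
    have hPP : ∀ a b, P a * P b + P b * P a = if a = b then 2 else 0 := by
      intro a b; ext i j
      fin_cases a <;> fin_cases b <;> fin_cases i <;> fin_cases j <;>
        simp [P, Matrix.ofNat_apply] <;> norm_num
    let D : Fin (2 * n) ⊕ Fin 2 → Matrix (Fin (2 ^ n) × Fin 2) (Fin (2 ^ n) × Fin 2) ℂ :=
      Sum.elim (fun j => Matrix.kronecker (c j) Z) (fun a => Matrix.kronecker 1 (P a))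
    have hDh : ∀ s, (D s).conjTranspose = D s := by
      rintro (j | a)
      · simp only [D, Sum.elim_inl, Matrix.kronecker, Matrix.conjTranspose_kronecker, hZh,
          (hc.isHermitian j).eq]
      · simp only [D, Sum.elim_inr, Matrix.kronecker, Matrix.conjTranspose_kronecker, hPh,
          Matrix.conjTranspose_one]
    have hDD : ∀ s t, D s * D t + D t * D s = if s = t then 2 else 0 := by
      have h2 : (2 : Matrix (Fin (2 ^ n) × Fin 2) (Fin (2 ^ n) × Fin 2) ℂ)
          = Matrix.kroneckerMap (· * ·) 2 1 := by
        rw [show (2 : Matrix (Fin (2 ^ n)) (Fin (2 ^ n)) ℂ) = 1 + 1 from one_add_one_eq_two.symm,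
          Matrix.add_kronecker, Matrix.one_kronecker_one, one_add_one_eq_two]
      have h2' : (2 : Matrix (Fin (2 ^ n) × Fin 2) (Fin (2 ^ n) × Fin 2) ℂ)
          = Matrix.kroneckerMap (· * ·) 1 2 := by
        rw [show (2 : Matrix (Fin 2) (Fin 2) ℂ) = 1 + 1 from one_add_one_eq_two.symm,
          Matrix.kronecker_add, Matrix.one_kronecker_one, one_add_one_eq_two]
      rintro (j | a) (k | b)
      · simp only [D, Sum.elim_inl, Matrix.kronecker, ← Matrix.mul_kronecker_mul, hZ,
          ← Matrix.add_kronecker, hc.anticomm, Sum.inl.injEq]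
        split_ifs
        · exact h2.symm
        · simp
      · simp only [D, Sum.elim_inl, Sum.elim_inr, Matrix.kronecker, ← Matrix.mul_kronecker_mul,
          hPZ, one_mul, mul_one, ← Matrix.kronecker_add]
        simp
      · simp only [D, Sum.elim_inl, Sum.elim_inr, Matrix.kronecker, ← Matrix.mul_kronecker_mul,
          hPZ, one_mul, mul_one, ← Matrix.kronecker_add]
        simp
      · simp only [D, Sum.elim_inr, Matrix.kronecker, ← Matrix.mul_kronecker_mul, mul_one,
          ← Matrix.kronecker_add, hPP, Sum.inr.injEq]
        split_ifs
        · exact h2'.symm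
        · simp
    let e : Fin (2 ^ n) × Fin 2 ≃ Fin (2 ^ (n + 1)) :=
      finProdFinEquiv.trans (finCongr (pow_succ 2 n).symm)
    let f : Fin (2 * (n + 1)) ≃ Fin (2 * n) ⊕ Fin 2 :=
      (finCongr (mul_add 2 n 1)).trans finSumFinEquiv.symm
    let Φ := Matrix.reindexAlgEquiv ℂ ℂ e
    refine ⟨fun j => Φ (D (f j)), fun j => ?_, fun j k => ?_⟩
    · change (Matrix.reindex e e (D (f j))).conjTranspose = Matrix.reindex e e (D (f j))
      rw [Matrix.conjTranspose_reindex, hDh]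
    · rw [← map_mul, ← map_mul, ← map_add, hDD]
      simp only [f.injective.eq_iff]
      split_ifs
      · exact map_ofNat Φ 2
      · exact map_zero Φ

/-- The Majorana monomial `C_I = i ^ (|I| / 2) c_{i₁} ⋯ c_{i_q}`, where `i₁ < ⋯ < i_q` are the
elements of `I`. -/
def majoranaMonomial {n : ℕ} (c : Fin (2 * n) → FockOp n) (I : Finset (Fin (2 * n))) :
    FockOp n :=
  Complex.I ^ (I.card / 2) • ((I.sort (· ≤ ·)).map c).prod

/-- The index set of the interactions: the subsets of size `q` of the `2n` Majorana modes. -/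
abbrev Interaction (n q : ℕ) : Type := {I : Finset (Fin (2 * n)) // I.card = q}

/-- The law of the couplings `(J_I)`: independent standard Gaussian random variables. -/
def couplingLaw (n q : ℕ) : MeasureTheory.Measure (Interaction n q → ℝ) :=
  MeasureTheory.Measure.pi fun _ => ProbabilityTheory.gaussianReal 0 1

/-- The SYK-`q` Hamiltonian with couplings `J`:
`H = binom(2n, q) ^ (-1/2) ∑_{|I| = q} J_I C_I`. -/
def hamiltonian {n q : ℕ} (c : Fin (2 * n) → FockOp n) (J : Interaction n q → ℝ) : FockOp n :=
  (((√((2 * n).choose q : ℝ))⁻¹ : ℝ) : ℂ) •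
    ∑ I : Interaction n q, ((J I : ℝ) : ℂ) • majoranaMonomial c I.1

/-- The unnormalized thermal operator `exp (-i ∑_{j ≠ k} β_{jk} c_j c_k)`. -/
def thermalOp {n : ℕ} (c : Fin (2 * n) → FockOp n) (β : Matrix (Fin (2 * n)) (Fin (2 * n)) ℝ) :
    FockOp n :=
  NormedSpace.exp (-(Complex.I •
    ∑ p ∈ (Finset.univ : Finset (Fin (2 * n))).offDiag,
      ((β p.1 p.2 : ℝ) : ℂ) • (c p.1 * c p.2)))

/-- The thermal Gaussian states: operators `exp (-i ∑_{j ≠ k} β_{jk} c_j c_k)` with `β` real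
antisymmetric, normalized to trace one. -/
def thermalGaussianStates {n : ℕ} (c : Fin (2 * n) → FockOp n) : Set (FockOp n) :=
  {ρ | ∃ β : Matrix (Fin (2 * n)) (Fin (2 * n)) ℝ, β.transpose = -β ∧
    ρ = (thermalOp c β).trace⁻¹ • thermalOp c β}

/-- Fermionic Gaussian states: thermal Gaussian states and their limits. The limits are the
zero-temperature states, e.g. all pure Gaussian states. -/
def IsGaussianState {n : ℕ} (c : Fin (2 * n) → FockOp n) (ρ : FockOp n) : Prop :=
  ρ ∈ closure (thermalGaussianStates c)

end SYK

end

noncomputable section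

namespace SYK

open scoped ComplexOrder

/-! Write q = 2m. For a thermal Gaussian state ρ, Wick's theorem turns Tr(Hρ) into
binom(2n,q)^(-1/2) ∑_I J_I Pf(Γ_I), where Γ is the covariance matrix of ρ. Exponentially large
operators thus reduce to a matrix with O(n²) entries, whose strictly upper part has squared
Frobenius norm at most n (`IsMajorana.norm_covarianceMatrix_sq_le`).

The Pfaffian is the diagonal of an m-linear form, `polarPfaffian`. At fixed matrices in the unit
ball, `interactionForm` is a centred Gaussian in J of variance at most (q-1)‼², uniformly in n
(`sum_strictMono_polarPfaffian_sq_le`). A net with exp(O(n²)) points and a union bound make the form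
O(n) on the unit ball, outside an event of probability at most e^(-n). Homogeneity contributes
n^(m/2) and the normalization n^(-m), so the energy is of order n^(1-m/2) = n^(1-q/4). Limits of
thermal states obey the same closed inequality.

Wick's theorem is proved without diagonalizing β: conjugation by ρ acts linearly on the span of the
c_j, and cyclicity of the trace then gives the expansion along the first operator. -/

/-! ### Matrix exponentials -/

open scoped Matrix.Norms.Operator in
/-- An operator `A` whose commutator acts on the range of a linear map `f` through `K` satisfies
`exp A * f v = f (exp K v) * exp A`. -/
theorem exp_mul_of_commutator {ι κ : Type*} [Fintype ι] [DecidableEq ι] [Fintype κ]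
    [DecidableEq κ] (f : (ι → ℂ) →ₗ[ℂ] Matrix κ κ ℂ) {A : Matrix κ κ ℂ} {K : Matrix ι ι ℂ}
    (h : ∀ v, A * f v - f v * A = f (K.mulVec v)) (v : ι → ℂ) :
    NormedSpace.exp A * f v = f ((NormedSpace.exp K).mulVec v) * NormedSpace.exp A := by
  let F : Matrix ι ι ℂ →L[ℝ] Matrix κ κ ℂ :=
    LinearMap.toContinuousLinearMap
      ((f.restrictScalars ℝ).comp ((Matrix.mulVecBilin ℝ ℝ).flip v))
  have hF : ∀ B, F B = f (B.mulVec v) := fun B => rfl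
  -- The commutator hypothesis makes this curve stationary; comparing t = 1 with t = 0 gives the
  -- claim.
  let g : ℝ → Matrix κ κ ℂ := fun t =>
    NormedSpace.exp (t • -A) * F (NormedSpace.exp (t • K)) * NormedSpace.exp (t • A)
  have hg : ∀ t, HasDerivAt g 0 t := by
    intro t
    have h1 := hasDerivAt_exp_smul_const (𝕂 := ℝ) (-A) t
    have h2 := F.hasFDerivAt.comp_hasDerivAt t (hasDerivAt_exp_smul_const' (𝕂 := ℝ) K t)
    have h3 := hasDerivAt_exp_smul_const' (𝕂 := ℝ) A t
    have h4 := (h1.mul h2).mul h3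
    refine h4.congr_deriv ?_
    have h5 := h ((NormedSpace.exp (t • K)).mulVec v)
    rw [Matrix.mulVec_mulVec] at h5
    change (NormedSpace.exp (t • -A) * -A * f ((NormedSpace.exp (t • K)).mulVec v)
      + NormedSpace.exp (t • -A) * f ((K * NormedSpace.exp (t • K)).mulVec v))
        * NormedSpace.exp (t • A) + NormedSpace.exp (t • -A) *
          f ((NormedSpace.exp (t • K)).mulVec v) * (A * NormedSpace.exp (t • A)) = 0
    rw [← h5]
    noncomm_ring
  have hconst : g 1 = g 0 := is_const_of_deriv_eq_zero (fun t => (hg t).differentiableAt)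
    (fun t => (hg t).deriv) 1 0
  have hinv : NormedSpace.exp A * NormedSpace.exp (-A) = 1 := by
    rw [← Matrix.exp_add_of_commute _ _ (Commute.refl A).neg_right]
    simp
  simp only [g, hF, one_smul, zero_smul, NormedSpace.exp_zero, one_mul, mul_one,
    Matrix.one_mulVec] at hconst
  rw [← hconst, ← mul_assoc, ← mul_assoc, hinv, one_mul]

/-- exp A = B* B with B = exp(A/2) Hermitian and invertible. -/
theorem posDef_exp {ι : Type*} [Fintype ι] [DecidableEq ι] {A : Matrix ι ι ℂ}
    (hA : A.IsHermitian) : (NormedSpace.exp A).PosDef := by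
  have hB : ((2⁻¹ : ℝ) • A).IsHermitian := by
    rw [Matrix.IsHermitian, Matrix.conjTranspose_smul, hA.eq]; simp
  have h : NormedSpace.exp A
      = (NormedSpace.exp ((2⁻¹ : ℝ) • A)).conjTranspose * NormedSpace.exp ((2⁻¹ : ℝ) • A) := by
    rw [hB.exp.eq, ← Matrix.exp_add_of_commute _ _ (Commute.refl _), ← add_smul]
    norm_num
  rw [h]
  exact Matrix.PosDef.conjTranspose_mul_self _
    (Matrix.mulVec_injective_of_isUnit (Matrix.isUnit_exp _))

/-! ### Majorana algebra -/

variable {n : ℕ} {c : Fin (2 * n) → FockOp n}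

/-- The complex linear combination `∑ v_j c_j` of Majorana operators. -/
def majoranaLin (c : Fin (2 * n) → FockOp n) : (Fin (2 * n) → ℂ) →ₗ[ℂ] FockOp n :=
  Fintype.linearCombination ℂ c

theorem majoranaLin_apply (v : Fin (2 * n) → ℂ) : majoranaLin c v = ∑ j, v j • c j :=
  Fintype.linearCombination_apply _ _ _

@[simp] theorem majoranaLin_single (j : Fin (2 * n)) : majoranaLin c (Pi.single j 1) = c j := by
  simp [majoranaLin]

theorem IsMajorana.lin_mul (hc : IsMajorana c) (u : Fin (2 * n) → ℂ) (k : Fin (2 * n)) :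
    majoranaLin c u * c k = (2 * u k) • 1 - c k * majoranaLin c u := by
  rw [eq_sub_iff_add_eq, majoranaLin_apply, Finset.sum_mul, Finset.mul_sum,
    ← Finset.sum_add_distrib]
  have : ∀ j, u j • c j * c k + c k * u j • c j = if j = k then (2 * u k) • 1 else 0 := by
    intro j
    rw [smul_mul_assoc, mul_smul_comm, ← smul_add, hc.anticomm]
    split_ifs with h
    · rw [h, mul_comm, mul_smul, two_smul, one_add_one_eq_two]
    · simp
  rw [Finset.sum_congr rfl fun j _ => this j]
  simp

/-- The product `c_{w 0} c_{w 1} ⋯` of Majorana operators. -/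
def majoranaProd (c : Fin (2 * n) → FockOp n) {r : ℕ} (w : Fin r → Fin (2 * n)) : FockOp n :=
  (List.ofFn fun i => c (w i)).prod

theorem majoranaProd_succ {r : ℕ} (w : Fin (r + 1) → Fin (2 * n)) :
    majoranaProd c w = c (w 0) * majoranaProd c (fun i => w i.succ) := by
  simp [majoranaProd, List.ofFn_succ]

@[simp] theorem majoranaProd_zero (w : Fin 0 → Fin (2 * n)) : majoranaProd c w = 1 := by
  simp [majoranaProd]

/-- Each factor passed contributes a sign and a scalar contraction, the anticommutator 2 u_(w k). -/
theorem IsMajorana.lin_mul_prod (hc : IsMajorana c) (u : Fin (2 * n) → ℂ) {r : ℕ}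
    (w : Fin (r + 1) → Fin (2 * n)) :
    majoranaLin c u * majoranaProd c w =
      (-1 : ℂ) ^ (r + 1) • (majoranaProd c w * majoranaLin c u)
        + ∑ k : Fin (r + 1), ((-1 : ℂ) ^ (k : ℕ) * (2 * u (w k))) •
            majoranaProd c (fun i => w (k.succAbove i)) := by
  induction r with
  | zero =>
    simp [majoranaProd_succ, hc.lin_mul]
    abel
  | succ r ih =>
    rw [Fin.sum_univ_succ, majoranaProd_succ, ← mul_assoc, hc.lin_mul, sub_mul, mul_assoc, ih]
    simp only [majoranaProd_succ (r := r),
      Fin.succ_succAbove_zero, Fin.succ_succAbove_succ, Fin.val_succ, Fin.val_zero, pow_zero,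
      one_mul, Fin.zero_succAbove, mul_add, Finset.mul_sum, mul_smul_comm, smul_mul_assoc,
      pow_succ _ (r + 1), mul_neg, mul_one, neg_mul, neg_smul, Finset.sum_neg_distrib,
      pow_succ _ (Fin.val _), mul_assoc]
    abel

/-! ### Thermal states and Wick's theorem -/

/-- The exponent `-i ∑_{j ≠ k} β_{jk} c_j c_k` of a thermal Gaussian state. -/
def thermalExponent (c : Fin (2 * n) → FockOp n) (β : Matrix (Fin (2 * n)) (Fin (2 * n)) ℝ) :
    FockOp n :=
  -(Complex.I • ∑ p ∈ (Finset.univ : Finset (Fin (2 * n))).offDiag,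
      ((β p.1 p.2 : ℝ) : ℂ) • (c p.1 * c p.2))

theorem thermalOp_eq_exp (β : Matrix (Fin (2 * n)) (Fin (2 * n)) ℝ) :
    thermalOp c β = NormedSpace.exp (thermalExponent c β) := rfl

theorem IsMajorana.conjTranspose_I_smul_mul (hc : IsMajorana c) {j k : Fin (2 * n)}
    (h : j ≠ k) : (Complex.I • (c j * c k)).conjTranspose = Complex.I • (c j * c k) := by
  have h1 := hc.anticomm j k
  rw [if_neg h, add_eq_zero_iff_eq_neg'] at h1
  rw [Matrix.conjTranspose_smul, Matrix.conjTranspose_mul, (hc.isHermitian j).eq,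
    (hc.isHermitian k).eq, h1]
  simp

theorem IsMajorana.isHermitian_thermalExponent (hc : IsMajorana c)
    (β : Matrix (Fin (2 * n)) (Fin (2 * n)) ℝ) : (thermalExponent c β).IsHermitian := by
  rw [thermalExponent, Finset.smul_sum]
  refine Matrix.IsHermitian.neg ?_
  rw [Matrix.IsHermitian, Matrix.conjTranspose_sum]
  refine Finset.sum_congr rfl fun p hp => ?_
  rw [smul_comm, Matrix.conjTranspose_smul,
    hc.conjTranspose_I_smul_mul (Finset.mem_offDiag.1 hp).2.2]
  simp

/-- A quadratic exponent preserves the span of the c_j under commutators. The 4 is a 2 from the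
anticommutator times a 2 from the antisymmetry of β. -/
theorem IsMajorana.commutator_thermalExponent (hc : IsMajorana c)
    {β : Matrix (Fin (2 * n)) (Fin (2 * n)) ℝ} (hβ : β.transpose = -β) (v : Fin (2 * n) → ℂ) :
    thermalExponent c β * majoranaLin c v - majoranaLin c v * thermalExponent c β
      = majoranaLin c (((-(4 * Complex.I)) • β.map (fun x : ℝ => (x : ℂ))).mulVec v) := by
  have hβ' : ∀ j k, β k j = -β j k := fun j k => congrFun (congrFun hβ j) k
  have hdiag : ∀ j, β j j = 0 := fun j => by linarith [hβ' j j]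
  have hA : thermalExponent c β
      = -(Complex.I • ∑ j, ∑ k, ((β j k : ℝ) : ℂ) • (c j * c k)) := by
    rw [thermalExponent, ← Fintype.sum_prod_type' (f := fun j k => ((β j k : ℝ) : ℂ) • (c j * c k))]
    congr 2
    refine Finset.sum_subset (Finset.subset_univ _) fun p _ hp => ?_
    have : p.1 = p.2 := by simpa using hp
    simp [this, hdiag]
  have hcomm : ∀ j k, c j * c k * majoranaLin c v - majoranaLin c v * (c j * c k)
      = (2 * v k) • c j - (2 * v j) • c k := by
    intro j k
    have h1 := hc.lin_mul v j
    have h2 := hc.lin_mul v k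
    have h3 : c k * majoranaLin c v = (2 * v k) • 1 - majoranaLin c v * c k := by rw [h2]; abel
    rw [mul_assoc, h3, ← mul_assoc, h1, mul_sub, sub_mul, ← mul_assoc]
    simp
  have key : (∑ j, ∑ k, ((β j k : ℝ) : ℂ) • (c j * c k)) * majoranaLin c v
      - majoranaLin c v * (∑ j, ∑ k, ((β j k : ℝ) : ℂ) • (c j * c k))
      = ∑ j, (4 * ∑ k, ((β j k : ℝ) : ℂ) * v k) • c j := by
    simp only [Finset.sum_mul, Finset.mul_sum, ← Finset.sum_sub_distrib, smul_mul_assoc,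
      mul_smul_comm, ← smul_sub, hcomm]
    simp only [smul_sub, Finset.sum_sub_distrib]
    rw [sub_eq_iff_eq_add, Finset.sum_comm (f := fun j k => ((β j k : ℝ) : ℂ) • (2 * v j) • c k),
      ← Finset.sum_add_distrib]
    refine Finset.sum_congr rfl fun j _ => ?_
    rw [Finset.sum_smul, ← Finset.sum_add_distrib]
    refine Finset.sum_congr rfl fun k _ => ?_
    rw [hβ' j k, smul_smul, smul_smul, ← add_smul]
    push_cast
    ring_nf
  rw [hA, neg_mul, mul_neg, smul_mul_assoc, mul_smul_comm, neg_sub_neg, ← smul_sub,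
    ← neg_sub, key, majoranaLin_apply, smul_neg, Finset.smul_sum, ← Finset.sum_neg_distrib]
  refine Finset.sum_congr rfl fun j _ => ?_
  rw [smul_smul, ← neg_smul]
  congr 1
  simp only [Matrix.mulVec, dotProduct, Matrix.smul_apply, Matrix.map_apply, smul_eq_mul,
    Finset.mul_sum, ← Finset.sum_neg_distrib]
  exact Finset.sum_congr rfl fun k _ => by ring

theorem IsMajorana.posDef_thermalOp (hc : IsMajorana c)
    (β : Matrix (Fin (2 * n)) (Fin (2 * n)) ℝ) : (thermalOp c β).PosDef :=
  posDef_exp (hc.isHermitian_thermalExponent β)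

/-- The thermal Gaussian state `exp (-i ∑ β_{jk} c_j c_k)`, normalized to trace one. -/
def thermalState (c : Fin (2 * n) → FockOp n) (β : Matrix (Fin (2 * n)) (Fin (2 * n)) ℝ) :
    FockOp n :=
  (thermalOp c β).trace⁻¹ • thermalOp c β

theorem IsMajorana.trace_thermalState (hc : IsMajorana c)
    (β : Matrix (Fin (2 * n)) (Fin (2 * n)) ℝ) : (thermalState c β).trace = 1 := by
  rw [thermalState, Matrix.trace_smul, smul_eq_mul,
    inv_mul_cancel₀ (hc.posDef_thermalOp β).trace_pos.ne']

theorem IsMajorana.posDef_thermalState (hc : IsMajorana c)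
    (β : Matrix (Fin (2 * n)) (Fin (2 * n)) ℝ) : (thermalState c β).PosDef :=
  (hc.posDef_thermalOp β).smul (inv_pos.2 (hc.posDef_thermalOp β).trace_pos)

/-- Wick's theorem for thermal Gaussian states, as an expansion along the first operator. -/
theorem IsMajorana.trace_thermalState_mul_prod (hc : IsMajorana c)
    {β : Matrix (Fin (2 * n)) (Fin (2 * n)) ℝ} (hβ : β.transpose = -β) {r : ℕ} (hr : Even r)
    (i : Fin (2 * n)) (w : Fin (r + 1) → Fin (2 * n)) :
    (thermalState c β * (c i * majoranaProd c w)).trace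
      = ∑ k : Fin (r + 1), (-1 : ℂ) ^ (k : ℕ) * (thermalState c β * (c i * c (w k))).trace *
          (thermalState c β * majoranaProd c (fun i => w (k.succAbove i))).trace := by
  set ρ := thermalState c β with hρ
  set K : Matrix (Fin (2 * n)) (Fin (2 * n)) ℂ :=
    (-(4 * Complex.I)) • β.map (fun x : ℝ => (x : ℂ)) with hK
  have hKh : K.IsHermitian := by
    ext j k
    have : β k j = -β j k := congrFun (congrFun hβ j) k
    simp [hK, this]
  set M := NormedSpace.exp K with hM
  -- A KMS relation: moving a linear form across ρ applies M = exp K.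
  have hkms : ∀ v, ρ * majoranaLin c v = majoranaLin c (M.mulVec v) * ρ := by
    intro v
    rw [hρ, thermalState, smul_mul_assoc, mul_smul_comm, thermalOp_eq_exp,
      exp_mul_of_commutator (majoranaLin c) (hc.commutator_thermalExponent hβ)]
  -- Invertibility of 1 + M lets c_i be split as c(u) + c(Mu). By KMS and cyclicity the first part
  -- may be moved to the far right as c(Mu); the product has odd length, so this cancels the term
  -- left by anticommuting the second part through, and only contractions survive.
  have hunit : IsUnit (1 + M) := (Matrix.PosDef.one.add (posDef_exp hKh)).isUnit
  obtain ⟨u, hu⟩ := (Matrix.mulVec_surjective_iff_isUnit.2 hunit) (Pi.single i 1)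
  have hci : c i = majoranaLin c u + majoranaLin c (M.mulVec u) := by
    rw [← map_add, ← majoranaLin_single (c := c), ← hu, Matrix.add_mulVec, Matrix.one_mulVec]
  have hexp : ∀ {r : ℕ} (_ : Even r) (w : Fin (r + 1) → Fin (2 * n)),
      (ρ * (c i * majoranaProd c w)).trace
        = ∑ k : Fin (r + 1), (-1 : ℂ) ^ (k : ℕ) * (2 * M.mulVec u (w k)) *
          (ρ * majoranaProd c (fun i => w (k.succAbove i))).trace := by
    intro r hr w
    have h1 : (ρ * (majoranaLin c u * majoranaProd c w)).trace
        = (ρ * (majoranaProd c w * majoranaLin c (M.mulVec u))).trace := by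
      rw [← mul_assoc, hkms, mul_assoc, Matrix.trace_mul_comm, mul_assoc]
    rw [hci, add_mul, mul_add, Matrix.trace_add, h1, hc.lin_mul_prod (M.mulVec u),
      hr.add_one.neg_one_pow, neg_one_smul, mul_add, mul_neg, Matrix.trace_add,
      Matrix.trace_neg, add_neg_cancel_left, Finset.mul_sum, Matrix.trace_sum]
    refine Finset.sum_congr rfl fun k _ => ?_
    rw [mul_smul_comm, Matrix.trace_smul, smul_eq_mul]
  -- The case r = 0 identifies the contraction with the two-point function, so Mu is never computed.
  have htwo : ∀ j, (ρ * (c i * c j)).trace = 2 * M.mulVec u j := by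
    intro j
    have := hexp (r := 0) (by simp) (fun _ => j)
    simpa [majoranaProd_succ, hρ, hc.trace_thermalState β] using this
  simp only [hexp hr w, htwo]

/-! ### Covariance matrices -/

theorem conj_trace_mul {ι : Type*} [Fintype ι] {ρ Y : Matrix ι ι ℂ} (hρ : ρ.IsHermitian)
    (hY : Y.IsHermitian) : (starRingEnd ℂ) (ρ * Y).trace = (ρ * Y).trace := by
  rw [starRingEnd_apply, ← Matrix.trace_conjTranspose, Matrix.conjTranspose_mul, hρ.eq, hY.eq,
    Matrix.trace_mul_comm]

theorem trace_mul_sq_nonneg {ι : Type*} [Fintype ι] {ρ Y : Matrix ι ι ℂ} (hρ : ρ.PosSemidef)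
    (hY : Y.IsHermitian) : 0 ≤ (ρ * (Y * Y)).trace := by
  have h := (hρ.conjTranspose_mul_mul_same Y).trace_nonneg
  rwa [hY.eq, Matrix.trace_mul_comm, ← mul_assoc, Matrix.trace_mul_comm] at h

/-- The covariance `Re Tr (i ρ c_j c_k)` of two Majorana operators. -/
def covariance (c : Fin (2 * n) → FockOp n) (ρ : FockOp n) (j k : Fin (2 * n)) : ℝ :=
  (ρ * (Complex.I • (c j * c k))).trace.re

theorem IsMajorana.trace_mul_eq_covariance (hc : IsMajorana c) {ρ : FockOp n}
    (hρ : ρ.IsHermitian) {j k : Fin (2 * n)} (h : j ≠ k) :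
    (ρ * (Complex.I • (c j * c k))).trace = covariance c ρ j k :=
  (Complex.conj_eq_iff_re.1 (conj_trace_mul hρ (hc.conjTranspose_I_smul_mul h))).symm

theorem IsMajorana.covariance_swap (hc : IsMajorana c) (ρ : FockOp n) {j k : Fin (2 * n)}
    (h : j ≠ k) : covariance c ρ k j = -covariance c ρ j k := by
  have h1 := hc.anticomm k j
  rw [if_neg h.symm, add_eq_zero_iff_eq_neg] at h1
  simp [covariance, h1]

/-- Each row of the covariance matrix of a state has Euclidean norm at most one. -/
theorem IsMajorana.sum_covariance_sq_le_one (hc : IsMajorana c) {ρ : FockOp n}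
    (hρ : ρ.PosSemidef) (htr : ρ.trace = 1) (j : Fin (2 * n)) :
    ∑ k ∈ Finset.univ.erase j, covariance c ρ j k ^ 2 ≤ 1 := by
  set a : Fin (2 * n) → ℝ := fun k => if k = j then 0 else covariance c ρ j k with ha
  set s : ℝ := ∑ k, a k ^ 2 with hs
  have hsum : ∑ k ∈ Finset.univ.erase j, covariance c ρ j k ^ 2 = s := by
    rw [hs, ← Finset.add_sum_erase _ _ (Finset.mem_univ j)]
    simp only [ha, if_true]
    rw [zero_pow two_ne_zero, zero_add]
    exact Finset.sum_congr rfl fun k hk => by rw [if_neg (Finset.ne_of_mem_erase hk)]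
  rw [hsum]
  obtain ⟨u, hu⟩ : ∃ u, u = majoranaLin c (fun k => (a k : ℂ)) := ⟨_, rfl⟩
  have hue : u = ∑ k, (a k : ℂ) • c k := by rw [hu, majoranaLin_apply]
  have huj : u * c j = -(c j * u) := by
    rw [hu, hc.lin_mul]; simp [ha]
  have huu : u * u = (s : ℂ) • 1 := by
    have h1 : u * u + u * u = (2 * s : ℂ) • 1 := by
      have h3 : u * u + u * u = ∑ k, (a k : ℂ) • (c k * u + u * c k) := by
        have h4 : ∑ k, (a k : ℂ) • (c k * u) = u * u := by
          simp only [← smul_mul_assoc, ← Finset.sum_mul, ← hue]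
        have h5 : ∑ k, (a k : ℂ) • (u * c k) = u * u := by
          simp only [← Matrix.mul_smul, ← Finset.mul_sum, ← hue]
        simp only [smul_add, Finset.sum_add_distrib, h4, h5]
      have h2 : ∀ k, c k * u + u * c k = (2 * (a k : ℂ)) • 1 := by
        intro k; rw [hu, hc.lin_mul]; abel
      rw [h3]
      simp only [h2, smul_smul, ← Finset.sum_smul, hs]
      congr 1
      push_cast
      rw [Finset.mul_sum]
      exact Finset.sum_congr rfl fun k _ => by ring
    rw [← two_smul ℂ, mul_smul] at h1
    exact smul_right_injective _ (two_ne_zero (α := ℂ)) h1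
  -- Since a_j = 0, u anticommutes with c_j, so Y is Hermitian with Y² = s and Tr(ρY) = s. The
  -- variance Tr ρ(Y - s)² = s - s² is nonnegative, hence s ≤ 1.
  obtain ⟨Y, hY⟩ : ∃ Y : FockOp n, Y = Complex.I • (c j * u) := ⟨_, rfl⟩
  have hYsum : Y = ∑ k, (a k : ℂ) • (Complex.I • (c j * c k)) := by
    rw [hY, hu, majoranaLin_apply, Finset.mul_sum, Finset.smul_sum]
    exact Finset.sum_congr rfl fun k _ => by rw [mul_smul_comm, smul_comm]
  have hYh : Y.IsHermitian := by
    rw [hYsum, Matrix.IsHermitian, Matrix.conjTranspose_sum]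
    refine Finset.sum_congr rfl fun k _ => ?_
    by_cases hk : k = j
    · simp [ha, hk]
    · rw [Matrix.conjTranspose_smul, hc.conjTranspose_I_smul_mul (Ne.symm hk)]
      simp
  have hcj : c j * c j = 1 := by
    have h1 := hc.anticomm j j
    have h2 : (2 : ℂ) • (c j * c j) = (2 : ℂ) • 1 := by
      rw [two_smul, h1, if_pos rfl, two_smul, one_add_one_eq_two]
    exact smul_right_injective _ (two_ne_zero (α := ℂ)) h2
  have hYY : Y * Y = (s : ℂ) • 1 := by
    rw [hY, smul_mul_smul_comm, Complex.I_mul_I, mul_assoc, ← mul_assoc u, huj, neg_mul,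
      mul_neg, mul_assoc, ← mul_assoc (c j) (c j), hcj, one_mul, huu]
    simp
  have hYtr : (ρ * Y).trace = s := by
    rw [hYsum, Finset.mul_sum, Matrix.trace_sum, hs]
    push_cast
    refine Finset.sum_congr rfl fun k _ => ?_
    by_cases hk : k = j
    · simp [ha, hk]
    · rw [mul_smul_comm, Matrix.trace_smul, hc.trace_mul_eq_covariance hρ.1 (Ne.symm hk)]
      simp [ha, hk, sq]
  have hZh : (Y - (s : ℂ) • (1 : FockOp n)).IsHermitian := by
    refine hYh.sub ?_
    rw [Matrix.IsHermitian, Matrix.conjTranspose_smul]; simp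
  have h := trace_mul_sq_nonneg hρ hZh
  have hexp : (Y - (s : ℂ) • (1 : FockOp n)) * (Y - (s : ℂ) • (1 : FockOp n))
      = Y * Y - (2 * s : ℂ) • Y + (s * s : ℂ) • (1 : FockOp n) := by
    simp only [sub_mul, mul_sub, smul_mul_assoc, mul_smul_comm, one_mul, mul_one]
    module
  rw [hexp, hYY, mul_add, mul_sub, mul_smul_comm, mul_smul_comm, mul_smul_comm, mul_one,
    Matrix.trace_add, Matrix.trace_sub, Matrix.trace_smul, Matrix.trace_smul,
    Matrix.trace_smul, htr, hYtr] at h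
  have h' : (0 : ℝ) ≤ s - s * s := by
    have : (0 : ℂ) ≤ ((s - s * s : ℝ) : ℂ) := by
      convert h using 1
      push_cast
      simp only [smul_eq_mul]
      ring
    exact_mod_cast this
  nlinarith [Finset.sum_nonneg fun k (_ : k ∈ Finset.univ) => sq_nonneg (a k)]

/-- The pairs `j < k` of elements of `Fin N`. -/
abbrev UpperPair (N : ℕ) : Type := {p : Fin N × Fin N // p.1 < p.2}

/-- Strictly upper triangular real `N × N` matrices with the Frobenius norm. -/
abbrev UpperMatrix (N : ℕ) : Type := EuclideanSpace ℝ (UpperPair N)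

/-- The strictly upper triangular part of the covariance matrix. -/
def covarianceMatrix (c : Fin (2 * n) → FockOp n) (ρ : FockOp n) : UpperMatrix (2 * n) :=
  WithLp.toLp 2 fun p => covariance c ρ p.1.1 p.1.2

/-- Summing the row bounds over 2n rows counts every pair twice. -/
theorem IsMajorana.norm_covarianceMatrix_sq_le (hc : IsMajorana c) {ρ : FockOp n}
    (hρ : ρ.PosSemidef) (htr : ρ.trace = 1) : ‖covarianceMatrix c ρ‖ ^ 2 ≤ n := by
  set f : Fin (2 * n) → Fin (2 * n) → ℝ := fun j k => covariance c ρ j k ^ 2 with hf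
  set S : ℝ := ∑ j, ∑ k, if j < k then f j k else 0 with hS
  have h1 : ‖covarianceMatrix c ρ‖ ^ 2 = S := by
    rw [EuclideanSpace.norm_sq_eq, hS,
      ← Fintype.sum_prod_type' (f := fun j k => if j < k then f j k else 0), ← Finset.sum_filter,
      Finset.sum_subtype (Finset.univ.filter fun p : Fin (2 * n) × Fin (2 * n) => p.1 < p.2)
        (p := fun p => p.1 < p.2) (by simp) (fun p => f p.1 p.2)]
    exact Finset.sum_congr rfl fun p _ => by
      rw [Real.norm_eq_abs, sq_abs]; rfl
  have h2 : S = ∑ j, ∑ k, if k < j then f j k else 0 := by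
    rw [hS, Finset.sum_comm]
    refine Finset.sum_congr rfl fun j _ => Finset.sum_congr rfl fun k _ => ?_
    split_ifs with h
    · simp only [hf, hc.covariance_swap ρ h.ne', neg_sq]
    · rfl
  have h3 : S + S = ∑ j, ∑ k ∈ Finset.univ.erase j, f j k := by
    conv_lhs => rw [h2]; arg 1; rw [← h2, hS]
    rw [← Finset.sum_add_distrib]
    refine Finset.sum_congr rfl fun j _ => ?_
    rw [← Finset.sum_add_distrib, ← Finset.sum_erase _ (a := j) (by simp)]
    refine Finset.sum_congr rfl fun k hk => ?_
    rcases lt_or_gt_of_ne (Finset.ne_of_mem_erase hk) with h | h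
    · simp [h, h.not_gt]
    · simp [h, h.not_gt]
  have h4 : S + S ≤ 2 * n := by
    rw [h3]
    refine (Finset.sum_le_sum fun j _ => hc.sum_covariance_sq_le_one hρ htr j).trans ?_
    simp
  linarith

/-! ### Polarized Pfaffians -/

/-- The `(j, k)` entry of a strictly upper triangular matrix. -/
def UpperMatrix.entry {N : ℕ} (j k : Fin N) : UpperMatrix N →ₗ[ℝ] ℝ :=
  if h : j < k then (EuclideanSpace.proj (𝕜 := ℝ) (⟨(j, k), h⟩ : UpperPair N)).toLinearMap else 0

/-- The polarized Pfaffian of the rows and columns `w` of `m` strictly upper triangular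
matrices. -/
def polarPfaffian {N : ℕ} : (m : ℕ) → (Fin (2 * m) → Fin N) →
    MultilinearMap ℝ (fun _ : Fin m => UpperMatrix N) ℝ
  | 0, _ => MultilinearMap.constOfIsEmpty ℝ _ 1
  | m + 1, w => LinearMap.uncurryLeft (∑ k : Fin (2 * m + 1), (-1 : ℝ) ^ (k : ℕ) •
      (UpperMatrix.entry (w 0) (w k.succ)).smulRight
        (polarPfaffian m fun i => w (k.succAbove i).succ))

theorem polarPfaffian_zero {N : ℕ} (w : Fin (2 * 0) → Fin N) (x : Fin 0 → UpperMatrix N) :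
    polarPfaffian 0 w x = 1 := rfl

theorem polarPfaffian_succ {N m : ℕ} (w : Fin (2 * m + 2) → Fin N)
    (x : Fin (m + 1) → UpperMatrix N) :
    polarPfaffian (m + 1) w x = ∑ k : Fin (2 * m + 1), (-1 : ℝ) ^ (k : ℕ) *
      (UpperMatrix.entry (w 0) (w k.succ) (x 0) *
        polarPfaffian m (fun i => w (k.succAbove i).succ) (Fin.tail x)) := by
  rw [polarPfaffian]
  simp [LinearMap.uncurryLeft_apply, sum_apply]

/-- Both sides satisfy the same first-row recursion. Monotonicity of w keeps every entry read above
the diagonal. -/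
theorem IsMajorana.trace_thermalState_mul_eq_polarPfaffian (hc : IsMajorana c)
    {β : Matrix (Fin (2 * n)) (Fin (2 * n)) ℝ} (hβ : β.transpose = -β) {m : ℕ}
    {w : Fin (2 * m) → Fin (2 * n)} (hw : StrictMono w) :
    (thermalState c β * (Complex.I ^ m • majoranaProd c w)).trace
      = (polarPfaffian m w fun _ => covarianceMatrix c (thermalState c β) : ℝ) := by
  induction m with
  | zero =>
    rw [polarPfaffian_zero]
    simp [hc.trace_thermalState]
  | succ m ih =>
    rw [polarPfaffian_succ (m := m) w]
    have h1 : majoranaProd c w = c (w 0) * majoranaProd c (fun i : Fin (2 * m + 1) => w i.succ) :=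
      majoranaProd_succ (r := 2 * m + 1) w
    rw [h1, mul_smul_comm, Matrix.trace_smul, hc.trace_thermalState_mul_prod hβ (by simp),
      smul_eq_mul, Finset.mul_sum]
    push_cast
    refine Finset.sum_congr rfl fun k _ => ?_
    have hlt : w 0 < w k.succ := hw (Fin.succ_pos k)
    have h2 := hc.trace_mul_eq_covariance (hc.posDef_thermalState β).1 hlt.ne
    have h3 := ih (w := fun i => w (k.succAbove i).succ)
      (fun i j hij => hw (Fin.succ_lt_succ_iff.2 (Fin.strictMono_succAbove k hij)))
    have h4 : UpperMatrix.entry (w 0) (w k.succ) (covarianceMatrix c (thermalState c β))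
        = covariance c (thermalState c β) (w 0) (w k.succ) := by
      rw [UpperMatrix.entry, dif_pos hlt]; rfl
    have h5 : Fin.tail (fun _ : Fin (m + 1) => covarianceMatrix c (thermalState c β))
        = fun _ => covarianceMatrix c (thermalState c β) := rfl
    rw [h4, h5, ← h3, ← h2, mul_smul_comm, mul_smul_comm, Matrix.trace_smul, Matrix.trace_smul,
      smul_eq_mul, smul_eq_mul, pow_succ]
    ring

theorem UpperMatrix.entry_apply {N : ℕ} (j k : Fin N) (x : UpperMatrix N) :
    UpperMatrix.entry j k x = if h : j < k then x ⟨(j, k), h⟩ else 0 := by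
  unfold UpperMatrix.entry
  split_ifs <;> rfl

theorem UpperMatrix.sum_entry_sq {N : ℕ} (x : UpperMatrix N) :
    ∑ j, ∑ k, UpperMatrix.entry j k x ^ 2 = ‖x‖ ^ 2 := by
  rw [EuclideanSpace.norm_sq_eq,
    ← Fintype.sum_prod_type' (f := fun j k => UpperMatrix.entry j k x ^ 2),
    ← Finset.sum_subset (Finset.subset_univ
      (Finset.univ.filter fun p : Fin N × Fin N => p.1 < p.2)) (fun p _ hp => by
        have : ¬ p.1 < p.2 := by simpa using hp
        simp [UpperMatrix.entry_apply, this]),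
    Finset.sum_subtype (Finset.univ.filter fun p : Fin N × Fin N => p.1 < p.2)
      (p := fun p => p.1 < p.2) (by simp)]
  refine Finset.sum_congr rfl fun p _ => ?_
  rw [Real.norm_eq_abs, sq_abs, UpperMatrix.entry_apply, dif_pos p.2]

-- Cauchy–Schwarz on the 2m+1 terms of the first-row expansion costs one factor 2m+1, and summing
-- the terms costs another. For a fixed term, forgetting the order relations between the removed
-- pair and the remaining indices factors the sum. The result does not depend on N.
open Classical in
theorem sum_strictMono_polarPfaffian_sq_le {N m : ℕ} (x : Fin m → UpperMatrix N) :
    ∑ w : Fin (2 * m) → Fin N, (if StrictMono w then polarPfaffian m w x ^ 2 else 0)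
      ≤ ((2 * m - 1)‼ : ℝ) ^ 2 * ∏ a, ‖x a‖ ^ 2 := by
  induction m with
  | zero =>
    have : IsEmpty (Fin (2 * 0)) := Fin.isEmpty
    have : Unique (Fin (2 * 0) → Fin N) := Pi.uniqueOfIsEmpty _
    rw [Fintype.sum_unique]
    simp [polarPfaffian_zero]
    split_ifs <;> norm_num
  | succ m ih =>
    set V : ℝ := ∑ w : Fin (2 * m) → Fin N,
      (if StrictMono w then polarPfaffian m w (Fin.tail x) ^ 2 else 0) with hV
    -- At m = 0, truncated subtraction gives 0‼ = 1, so that case is separate.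
    have hdf : ((2 * (m + 1) - 1)‼ : ℝ) = (2 * m + 1) * ((2 * m - 1)‼ : ℝ) := by
      rcases m with _ | m
      · simp
      · have : 2 * (m + 1 + 1) - 1 = (2 * (m + 1) - 1) + 2 := by omega
        rw [this, Nat.doubleFactorial_add_two]
        have : 2 * (m + 1) - 1 + 2 = 2 * (m + 1) + 1 := by omega
        rw [this]; push_cast; ring
    have hk : ∀ k : Fin (2 * m + 1), ∑ w : Fin (2 * m + 2) → Fin N,
        (if StrictMono w then (UpperMatrix.entry (w 0) (w k.succ) (x 0) *
          polarPfaffian m (fun i => w (k.succAbove i).succ) (Fin.tail x)) ^ 2 else 0)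
        ≤ ‖x 0‖ ^ 2 * V := by
      intro k
      rw [← (Fin.consEquiv (fun _ : Fin (2 * m + 2) => Fin N)).sum_comp, Fintype.sum_prod_type,
        ← UpperMatrix.sum_entry_sq, Finset.sum_mul]
      refine Finset.sum_le_sum fun a _ => ?_
      rw [← (Fin.insertNthEquiv (fun _ : Fin (2 * m + 1) => Fin N) k).sum_comp,
        Fintype.sum_prod_type, Finset.sum_mul]
      refine Finset.sum_le_sum fun b _ => ?_
      rw [hV, Finset.mul_sum]
      refine Finset.sum_le_sum fun w _ => ?_
      simp only [Fin.consEquiv_apply, Fin.insertNthEquiv_apply, Fin.cons_zero, Fin.cons_succ,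
        Fin.insertNth_apply_same, Fin.insertNth_apply_succAbove]
      by_cases h : StrictMono w
      · rw [if_pos h, mul_pow]
        split_ifs
        · exact le_rfl
        · positivity
      · rw [if_neg h, if_neg, mul_zero]
        intro h'
        refine h fun i j hij => ?_
        have := h' (Fin.succ_lt_succ_iff.2 (Fin.strictMono_succAbove k hij))
        simpa using this
    calc ∑ w : Fin (2 * m + 2) → Fin N,
          (if StrictMono w then polarPfaffian (m + 1) w x ^ 2 else 0)
        ≤ ∑ w : Fin (2 * m + 2) → Fin N, (2 * m + 1) * ∑ k : Fin (2 * m + 1),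
          (if StrictMono w then (UpperMatrix.entry (w 0) (w k.succ) (x 0) *
            polarPfaffian m (fun i => w (k.succAbove i).succ) (Fin.tail x)) ^ 2 else 0) := by
          refine Finset.sum_le_sum fun w _ => ?_
          split_ifs with h
          · rw [polarPfaffian_succ]
            refine (sq_sum_le_card_mul_sum_sq).trans (le_of_eq ?_)
            simp [mul_pow, ← pow_mul, mul_comm]
          · simp
      _ = (2 * m + 1) * ∑ k : Fin (2 * m + 1), ∑ w : Fin (2 * m + 2) → Fin N,
          (if StrictMono w then (UpperMatrix.entry (w 0) (w k.succ) (x 0) *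
            polarPfaffian m (fun i => w (k.succAbove i).succ) (Fin.tail x)) ^ 2 else 0) := by
          rw [← Finset.mul_sum, Finset.sum_comm]
      _ ≤ (2 * m + 1) * ∑ k : Fin (2 * m + 1), ‖x 0‖ ^ 2 * V := by
          gcongr with k; exact hk k
      _ = (2 * m + 1) ^ 2 * (‖x 0‖ ^ 2 * V) := by simp; ring
      _ ≤ (2 * m + 1) ^ 2 * (‖x 0‖ ^ 2 * (((2 * m - 1)‼ : ℝ) ^ 2 *
            ∏ a, ‖Fin.tail x a‖ ^ 2)) := by gcongr; exact ih _
      _ = _ := by rw [hdf, Fin.prod_univ_succ]; simp only [Fin.tail]; ring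

/-! ### Gaussian tails and nets -/

-- The sum is sub-Gaussian with proxy ∑ a_i², which may be enlarged to s; Chernoff's bound is
-- applied to both signs.
open MeasureTheory ProbabilityTheory in
theorem gaussian_tail {ι : Type*} [Fintype ι] (a : ι → ℝ) {s t : ℝ} (hs : 0 < s) (ht : 0 ≤ t)
    (ha : ∑ i, a i ^ 2 ≤ s) :
    (Measure.pi fun _ : ι => gaussianReal 0 1).real {J | t ≤ |∑ i, J i * a i|}
      ≤ 2 * Real.exp (-t ^ 2 / (2 * s)) := by
  set μ := Measure.pi fun _ : ι => gaussianReal 0 1 with hμ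
  have hind : iIndepFun (fun i (J : ι → ℝ) => J i * a i) μ :=
    iIndepFun_pi (X := fun i (r : ℝ) => r * a i) fun i => by fun_prop
  have hsub : ∀ i, HasSubgaussianMGF (fun J : ι → ℝ => J i * a i) (Real.toNNReal (a i ^ 2)) μ := by
    intro i
    have h0 : HasSubgaussianMGF (fun r : ℝ => r * a i) (Real.toNNReal (a i ^ 2))
        (gaussianReal 0 1) := by
      refine ⟨fun u => ?_, fun u => ?_⟩
      · have := integrable_exp_mul_gaussianReal (μ := 0) (v := 1) (u * a i)
        refine this.congr (Filter.Eventually.of_forall fun r => ?_)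
        simp only; ring_nf
      · have := congrFun (mgf_id_gaussianReal (μ := 0) (v := 1)) (u * a i)
        simp only [mgf, id] at this ⊢
        rw [show (fun r : ℝ => Real.exp (u * (r * a i))) = fun r => Real.exp (u * a i * r) by
          ext r; ring_nf, this, Real.coe_toNNReal _ (sq_nonneg _)]
        simp; ring_nf; exact le_rfl
    have hmap : μ.map (Function.eval i) = gaussianReal 0 1 :=
      (measurePreserving_eval (fun _ : ι => gaussianReal 0 1) i).map_eq
    rw [← hmap] at h0
    exact HasSubgaussianMGF.of_map (μ := μ) (Y := Function.eval i) (X := fun r : ℝ => r * a i)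
      (measurable_pi_apply i).aemeasurable h0
  have hsum := HasSubgaussianMGF.sum_of_iIndepFun hind (s := Finset.univ) fun i _ => hsub i
  have hc : ((∑ i, Real.toNNReal (a i ^ 2) : NNReal) : ℝ) ≤ s := by
    push_cast
    simpa [Real.coe_toNNReal _ (sq_nonneg _)] using ha
  have hone : ∀ X : (ι → ℝ) → ℝ, HasSubgaussianMGF X (∑ i, Real.toNNReal (a i ^ 2)) μ →
      μ.real {J | t ≤ X J} ≤ Real.exp (-t ^ 2 / (2 * s)) := by
    intro X hX
    have hX' : HasSubgaussianMGF X s.toNNReal μ := by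
      refine ⟨hX.integrable_exp_mul, fun u => (hX.mgf_le u).trans ?_⟩
      rw [Real.coe_toNNReal _ hs.le]
      gcongr
    have := hX'.measure_ge_le ht
    rwa [Real.coe_toNNReal _ hs.le] at this
  have h1 := hone _ hsum
  have h2 := hone _ hsum.neg
  calc μ.real {J | t ≤ |∑ i, J i * a i|}
      ≤ μ.real ({J | t ≤ ∑ i, J i * a i} ∪ {J | t ≤ -(∑ i, J i * a i)}) :=
        measureReal_mono (fun J (hJ : t ≤ |_|) => le_abs.1 hJ)
    _ ≤ _ := measureReal_union_le _ _
    _ ≤ _ := by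
        rw [two_mul]
        refine add_le_add ?_ ?_
        · simpa using h1
        · simpa using h2

theorem sum_Icc_two_inv_pow_natAbs (R : ℕ) :
    ∑ z ∈ Finset.Icc (-(R : ℤ)) R, (2⁻¹ : ℝ) ^ z.natAbs = 3 - 2 * 2⁻¹ ^ R := by
  induction R with
  | zero => norm_num
  | succ R ih =>
    have : Finset.Icc (-((R + 1 : ℕ) : ℤ)) ((R + 1 : ℕ) : ℤ)
        = insert ((R : ℤ) + 1) (insert (-((R : ℤ) + 1)) (Finset.Icc (-(R : ℤ)) R)) := by
      ext z; simp only [Finset.mem_Icc, Finset.mem_insert]; omega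
    rw [this, Finset.sum_insert, Finset.sum_insert, ih, Int.natAbs_neg]
    · have : ((R : ℤ) + 1).natAbs = R + 1 := by omega
      rw [this]; ring
    · simp
    · simp only [Finset.mem_Icc, Finset.mem_insert]; omega

/-- The number of integer vectors with `ℓ¹` norm at most `R`. -/
theorem card_l1_ball_le (ι : Type*) [Fintype ι] [DecidableEq ι] (R : ℕ) :
    (((Fintype.piFinset fun _ : ι => Finset.Icc (-(R : ℤ)) R).filter
      fun z => ∑ i, (z i).natAbs ≤ R).card : ℝ) ≤ 2 ^ R * 3 ^ Fintype.card ι := by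
  rw [Finset.cast_card]
  -- The weight 2^(R - ‖z‖₁) is at least 1 on the ball and factors over coordinates, each factor
  -- being below 3.
  calc ∑ z ∈ (Fintype.piFinset fun _ : ι => Finset.Icc (-(R : ℤ)) R).filter
        (fun z => ∑ i, (z i).natAbs ≤ R), (1 : ℝ)
      ≤ ∑ z ∈ (Fintype.piFinset fun _ : ι => Finset.Icc (-(R : ℤ)) R).filter
        (fun z => ∑ i, (z i).natAbs ≤ R), 2 ^ R * ∏ i, (2⁻¹ : ℝ) ^ (z i).natAbs := by
        refine Finset.sum_le_sum fun z hz => ?_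
        rw [Finset.prod_pow_eq_pow_sum]
        calc (1 : ℝ) = 2 ^ R * 2⁻¹ ^ R := by rw [← mul_pow]; norm_num
          _ ≤ _ := mul_le_mul_of_nonneg_left
            (pow_le_pow_of_le_one (by norm_num) (by norm_num) (Finset.mem_filter.1 hz).2)
            (by positivity)
    _ ≤ ∑ z ∈ Fintype.piFinset fun _ : ι => Finset.Icc (-(R : ℤ)) R,
        2 ^ R * ∏ i, (2⁻¹ : ℝ) ^ (z i).natAbs :=
        Finset.sum_le_sum_of_subset_of_nonneg (Finset.filter_subset _ _)
          fun _ _ _ => by positivity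
    _ = 2 ^ R * (3 - 2 * 2⁻¹ ^ R) ^ Fintype.card ι := by
        rw [← Finset.mul_sum, Finset.sum_prod_piFinset _ fun (_ : ι) (z : ℤ) => (2⁻¹ : ℝ) ^ z.natAbs]
        simp only [sum_Icc_two_inv_pow_natAbs, Finset.prod_const, Finset.card_univ]
    _ ≤ 2 ^ R * 3 ^ Fintype.card ι := by
        have h : (2⁻¹ : ℝ) ^ R ≤ 1 := pow_le_one₀ (by norm_num) (by norm_num)
        have h' : (0 : ℝ) < 2⁻¹ ^ R := by positivity
        gcongr
        · linarith
        · linarith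

/-- Rounding toward zero never increases a coordinate, which keeps the net inside the unit ball. -/
theorem exists_int_truncation (r : ℝ) : ∃ z : ℤ, |(z : ℝ)| ≤ |r| ∧ |r - z| ≤ 1 := by
  rcases le_total 0 r with h | h
  · have h0 : (0 : ℝ) ≤ ⌊r⌋ := by exact_mod_cast Int.floor_nonneg.2 h
    refine ⟨⌊r⌋, ?_, ?_⟩
    · rw [abs_of_nonneg h0, abs_of_nonneg h]; exact Int.floor_le r
    · rw [abs_le]; constructor <;> linarith [Int.floor_le r, Int.lt_floor_add_one r]
  · have h0 : (⌈r⌉ : ℝ) ≤ 0 := by exact_mod_cast Int.ceil_nonpos.2 h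
    refine ⟨⌈r⌉, ?_, ?_⟩
    · rw [abs_of_nonpos h0, abs_of_nonpos h]; linarith [Int.le_ceil r]
    · rw [abs_le]; constructor <;> linarith [Int.le_ceil r, Int.ceil_lt_add_one r]

/-- The Euclidean unit ball has a `1 / q`-net of at most `(3 * 2 ^ q) ^ d` points. -/
theorem exists_net (ι : Type*) [Fintype ι] [Nonempty ι] {q : ℕ} (hq : 0 < q) :
    ∃ S : Finset (EuclideanSpace ℝ ι), (S.card : ℝ) ≤ (3 * 2 ^ q) ^ Fintype.card ι ∧
      (∀ y ∈ S, ‖y‖ ≤ 1) ∧ ∀ x, ‖x‖ ≤ 1 → ∃ y ∈ S, ‖x - y‖ ≤ 1 / q := by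
  classical
  set d := Fintype.card ι with hd
  have hd0 : (0 : ℝ) < d := by exact_mod_cast Fintype.card_pos
  have hq0 : (0 : ℝ) < q := by exact_mod_cast hq
  have hsd : (0 : ℝ) < √d := Real.sqrt_pos.2 hd0
  -- Coordinate errors at most h give Euclidean error at most h√d = 1/q; and ‖x‖₁ ≤ √d puts the
  -- rounded integer vector in the ℓ¹ ball of radius √d/h = qd.
  set h : ℝ := (q * √d)⁻¹ with hh
  have hh0 : 0 < h := by positivity
  let Z := (Fintype.piFinset fun _ : ι => Finset.Icc (-((q * d : ℕ) : ℤ)) (q * d : ℕ)).filter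
      fun z => ∑ i, (z i).natAbs ≤ q * d
  let S := (Z.image fun z => (WithLp.toLp 2 fun i => h * z i : EuclideanSpace ℝ ι)).filter
    fun y => ‖y‖ ≤ 1
  refine ⟨S, ?_, fun y hy => (Finset.mem_filter.1 hy).2, fun x hx => ?_⟩
  · have h1 : S.card ≤ Z.card := (Finset.card_filter_le _ _).trans Finset.card_image_le
    calc (S.card : ℝ) ≤ Z.card := by exact_mod_cast h1
      _ ≤ 2 ^ (q * d) * 3 ^ d := card_l1_ball_le ι (q * d)
      _ = _ := by rw [mul_pow, pow_mul, mul_comm]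
  · choose z hz1 hz2 using fun i => exists_int_truncation (x i / h)
    have hxs : ∑ i, x i ^ 2 ≤ 1 := by
      have := EuclideanSpace.norm_sq_eq x
      simp only [Real.norm_eq_abs, sq_abs] at this
      rw [← this]; exact pow_le_one₀ (norm_nonneg _) hx
    have hcoord : ∀ i, |h * z i| ≤ |x i| := by
      intro i
      have := mul_le_mul_of_nonneg_left (hz1 i) hh0.le
      rw [abs_div, abs_of_pos hh0, mul_div_cancel₀ _ hh0.ne'] at this
      rwa [abs_mul, abs_of_pos hh0]
    have hdiff : ∀ i, |x i - h * z i| ≤ h := by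
      intro i
      have := mul_le_mul_of_nonneg_left (hz2 i) hh0.le
      rwa [← abs_of_pos hh0, ← abs_mul, abs_of_pos hh0, mul_sub, mul_div_cancel₀ _ hh0.ne',
        mul_one] at this
    have hl1 : ∑ i, |x i| ≤ √d := by
      refine Real.le_sqrt_of_sq_le ?_
      have := sq_sum_le_card_mul_sum_sq (s := Finset.univ) (f := fun i => |x i|)
      simp only [sq_abs, Finset.card_univ] at this
      nlinarith
    have hl1z : ∑ i, (z i).natAbs ≤ q * d := by
      have h1 : ((∑ i, (z i).natAbs : ℕ) : ℝ) ≤ ((q * d : ℕ) : ℝ) := by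
        push_cast
        calc ∑ i, ((z i).natAbs : ℝ) ≤ ∑ i, |x i| / h := by
              refine Finset.sum_le_sum fun i _ => ?_
              have := hz1 i
              rw [abs_div, abs_of_pos hh0] at this
              rwa [Nat.cast_natAbs, Int.cast_abs]
          _ = (∑ i, |x i|) * (q * √d) := by rw [← Finset.sum_div, hh, div_inv_eq_mul]
          _ ≤ √d * (q * √d) := by gcongr
          _ = q * d := by rw [mul_left_comm, Real.mul_self_sqrt hd0.le]
      exact_mod_cast h1
    refine ⟨WithLp.toLp 2 fun i => h * z i, ?_, ?_⟩
    · refine Finset.mem_filter.2 ⟨Finset.mem_image.2 ⟨z, Finset.mem_filter.2 ⟨?_, hl1z⟩, rfl⟩, ?_⟩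
      · refine Fintype.mem_piFinset.2 fun i => ?_
        have := (Finset.single_le_sum (f := fun i => (z i).natAbs) (fun _ _ => Nat.zero_le _)
          (Finset.mem_univ i)).trans hl1z
        rw [Finset.mem_Icc]
        omega
      · rw [EuclideanSpace.norm_eq, Real.sqrt_le_one]
        refine le_trans (Finset.sum_le_sum fun i _ => ?_) hxs
        simp only [Real.norm_eq_abs, sq_abs]
        exact sq_le_sq.2 (hcoord i)
    · rw [EuclideanSpace.norm_eq, Real.sqrt_le_left (by positivity)]
      calc ∑ i, ‖(x - WithLp.toLp 2 fun i => h * (z i : ℝ)) i‖ ^ 2 ≤ ∑ _i : ι, h ^ 2 := by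
            refine Finset.sum_le_sum fun i _ => ?_
            simp only [PiLp.sub_apply, Real.norm_eq_abs]
            exact pow_le_pow_left₀ (abs_nonneg _) (hdiff i) 2
        _ = d * h ^ 2 := by simp [hd]
        _ = (1 / q) ^ 2 := by
            rw [hh, inv_pow, mul_pow, Real.sq_sqrt hd0.le]
            field_simp
        _ ≤ _ := le_rfl

/-- A multilinear form bounded by `t` on a `1 / (2 m)`-net is bounded by `2 t` on the unit
ball. -/
theorem multilinear_le_of_net {E : Type*} [NormedAddCommGroup E] [NormedSpace ℝ E]
    {m : ℕ} (f : ContinuousMultilinearMap ℝ (fun _ : Fin m => E) ℝ) {S : Set E}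
    (hS : ∀ y ∈ S, ‖y‖ ≤ 1) (hnet : ∀ x : E, ‖x‖ ≤ 1 → ∃ y ∈ S, ‖x - y‖ ≤ 1 / (2 * m : ℕ))
    {t : ℝ} (ht : 0 ≤ t) (hf : ∀ y : Fin m → E, (∀ i, y i ∈ S) → |f y| ≤ t)
    (x : Fin m → E) : |f x| ≤ 2 * t * ∏ i, ‖x i‖ := by
  -- Replacing m arguments by net points costs m · ‖f‖/(2m) = ‖f‖/2, which is then absorbed: ‖f‖ ≤ t
  -- + ‖f‖/2 forces ‖f‖ ≤ 2t.
  have hball : ∀ u : Fin m → E, (∀ i, ‖u i‖ ≤ 1) → |f u| ≤ t + ‖f‖ / 2 := by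
    intro u hu
    choose y hyS hy using fun i => hnet (u i) (hu i)
    have h1 := f.norm_image_sub_le u y
    have h2 : ‖u‖ ≤ 1 := (pi_norm_le_iff_of_nonneg zero_le_one).2 hu
    have h3 : ‖y‖ ≤ 1 := (pi_norm_le_iff_of_nonneg zero_le_one).2 fun i => hS _ (hyS i)
    have h4 : ‖u - y‖ ≤ 1 / (2 * m : ℕ) := (pi_norm_le_iff_of_nonneg (by positivity)).2 hy
    have h5 : ‖f u - f y‖ ≤ ‖f‖ / 2 := by
      refine h1.trans ?_
      calc ‖f‖ * (Fintype.card (Fin m)) * max ‖u‖ ‖y‖ ^ (Fintype.card (Fin m) - 1) * ‖u - y‖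
          ≤ ‖f‖ * (Fintype.card (Fin m)) * 1 * (1 / (2 * m : ℕ)) := by
            gcongr
            exact pow_le_one₀ (by positivity) (max_le h2 h3)
        _ ≤ ‖f‖ / 2 := by
            rcases Nat.eq_zero_or_pos m with rfl | hm
            · simp; positivity
            · have : (0 : ℝ) < m := by exact_mod_cast hm
              simp only [Fintype.card_fin]; push_cast
              apply le_of_eq; field_simp
    have h6 := hf y hyS
    rw [Real.norm_eq_abs] at h5
    have := abs_add_le (f u - f y) (f y)
    rw [sub_add_cancel] at this
    linarith
  have hbound : ∀ x : Fin m → E, ‖f x‖ ≤ (t + ‖f‖ / 2) * ∏ i, ‖x i‖ := by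
    intro x
    have hx : x = fun i => ‖x i‖ • (‖x i‖⁻¹ • x i) := by
      ext i
      by_cases h : x i = 0
      · simp [h]
      · rw [smul_smul, mul_inv_cancel₀ (norm_ne_zero_iff.2 h), one_smul]
    conv_lhs => rw [hx, f.map_smul_univ]
    rw [norm_smul, mul_comm, Real.norm_eq_abs, Real.norm_of_nonneg (by positivity)]
    gcongr
    refine hball _ fun i => ?_
    rw [norm_smul, norm_inv, norm_norm]
    exact inv_mul_le_one
  have hle : ‖f‖ ≤ t + ‖f‖ / 2 := f.opNorm_le_bound (by positivity) hbound
  refine (f.le_opNorm x).trans ?_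
  gcongr
  linarith

theorem continuous_polarPfaffian {N m : ℕ} (w : Fin (2 * m) → Fin N) :
    Continuous (polarPfaffian m w) := by
  induction m with
  | zero => exact continuous_const
  | succ m ih =>
    have h : ⇑(polarPfaffian (m + 1) w) = fun x => ∑ k : Fin (2 * m + 1), (-1 : ℝ) ^ (k : ℕ) *
        (UpperMatrix.entry (w 0) (w k.succ) (x 0) *
          polarPfaffian m (fun i => w (k.succAbove i).succ) (Fin.tail x)) :=
      funext (polarPfaffian_succ (m := m) w)
    rw [h]
    refine continuous_finsetSum _ fun k _ => continuous_const.mul (Continuous.mul ?_ ?_)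
    · exact (LinearMap.continuous_of_finiteDimensional _).comp (continuous_apply 0)
    · exact (ih _).comp (continuous_pi fun i => continuous_apply i.succ)

/-! ### The random form and the union bound -/

variable {m : ℕ}

/-- The increasing enumeration of an interaction. -/
def Interaction.enum {q : ℕ} (I : Interaction n q) : Fin q → Fin (2 * n) :=
  I.1.orderEmbOfFin I.2

theorem Interaction.strictMono_enum {q : ℕ} (I : Interaction n q) :
    StrictMono (Interaction.enum I) :=
  (I.1.orderEmbOfFin I.2).strictMono

theorem Interaction.enum_injective {q : ℕ} :
    Function.Injective (Interaction.enum : Interaction n q → Fin q → Fin (2 * n)) := by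
  intro I I' h
  have h1 := Finset.range_orderEmbOfFin I.1 I.2
  have h2 := Finset.range_orderEmbOfFin I'.1 I'.2
  refine Subtype.ext (Finset.coe_injective ?_)
  rw [← h1, ← h2]
  exact congrArg Set.range h

theorem majoranaMonomial_eq (c : Fin (2 * n) → FockOp n) (I : Interaction n (2 * m)) :
    majoranaMonomial c I.1 = Complex.I ^ m • majoranaProd c (Interaction.enum I) := by
  have h : (I.1.sort (· ≤ ·)).map c = List.ofFn fun i => c (Interaction.enum I i) := by
    refine List.ext_getElem (by simp [I.2]) fun i h1 h2 => ?_
    simp [Interaction.enum, Finset.orderEmbOfFin_apply]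
  rw [majoranaMonomial, majoranaProd, h, I.2, Nat.mul_div_cancel_left _ two_pos]

/-- The random multilinear form `∑_I J_I Pf_I` on strictly upper triangular matrices. -/
def interactionForm (J : Interaction n (2 * m) → ℝ) :
    ContinuousMultilinearMap ℝ (fun _ : Fin m => UpperMatrix (2 * n)) ℝ :=
  ∑ I, J I • ⟨polarPfaffian m (Interaction.enum I), continuous_polarPfaffian _⟩

theorem interactionForm_apply (J : Interaction n (2 * m) → ℝ)
    (x : Fin m → UpperMatrix (2 * n)) :
    interactionForm J x = ∑ I, J I * polarPfaffian m (Interaction.enum I) x := by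
  simp only [interactionForm, sum_apply, smul_apply, smul_eq_mul]
  rfl

theorem IsMajorana.trace_hamiltonian_mul_thermalState {c : Fin (2 * n) → FockOp n}
    (hc : IsMajorana c) {β : Matrix (Fin (2 * n)) (Fin (2 * n)) ℝ} (hβ : β.transpose = -β)
    (J : Interaction n (2 * m) → ℝ) :
    (hamiltonian c J * thermalState c β).trace = (((√((2 * n).choose (2 * m) : ℝ))⁻¹ *
      interactionForm J (fun _ => covarianceMatrix c (thermalState c β)) : ℝ) : ℂ) := by
  rw [Matrix.trace_mul_comm, hamiltonian, mul_smul_comm, Matrix.trace_smul, smul_eq_mul,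
    Finset.mul_sum, Matrix.trace_sum, interactionForm_apply]
  push_cast
  congr 1
  refine Finset.sum_congr rfl fun I _ => ?_
  rw [mul_smul_comm, Matrix.trace_smul, smul_eq_mul, majoranaMonomial_eq,
    hc.trace_thermalState_mul_eq_polarPfaffian hβ (Interaction.strictMono_enum I)]

/-- The left side is the variance of `interactionForm` at x; interactions inject into increasing
words. -/
theorem sum_polarPfaffian_enum_sq_le (x : Fin m → UpperMatrix (2 * n)) :
    ∑ I : Interaction n (2 * m), polarPfaffian m (Interaction.enum I) x ^ 2
      ≤ ((2 * m - 1)‼ : ℝ) ^ 2 * ∏ a, ‖x a‖ ^ 2 := by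
  classical
  refine le_trans ?_ (sum_strictMono_polarPfaffian_sq_le x)
  rw [← Finset.sum_filter]
  refine (Finset.sum_map Finset.univ ⟨Interaction.enum, Interaction.enum_injective⟩
    (fun w => polarPfaffian m w x ^ 2)).symm.trans_le ?_
  refine Finset.sum_le_sum_of_subset_of_nonneg (fun w hw => ?_) fun _ _ _ => sq_nonneg _
  obtain ⟨I, _, rfl⟩ := Finset.mem_map.1 hw
  exact Finset.mem_filter.2 ⟨Finset.mem_univ _, Interaction.strictMono_enum I⟩

open MeasureTheory in
theorem one_sub_le_couplingLaw_real_interactionForm (hn : 0 < n) (hm : 0 < m) {t : ℝ}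
    (ht : 0 ≤ t) :
    1 - ((3 * 2 ^ (2 * m) : ℝ) ^ Fintype.card (UpperPair (2 * n))) ^ m *
        (2 * Real.exp (-t ^ 2 / (2 * ((2 * m - 1)‼ : ℝ) ^ 2)))
      ≤ (couplingLaw n (2 * m)).real
        {J | ∀ x, |interactionForm J x| ≤ 2 * t * ∏ a, ‖x a‖} := by
  classical
  have : Nonempty (UpperPair (2 * n)) :=
    ⟨⟨(⟨0, by omega⟩, ⟨1, by omega⟩), by simp [Fin.lt_def]⟩⟩
  obtain ⟨S, hcard, hball, hnet⟩ := exists_net (UpperPair (2 * n)) (q := 2 * m) (by omega)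
  set μ := couplingLaw n (2 * m) with hμ
  have : IsProbabilityMeasure μ := by rw [hμ, couplingLaw]; infer_instance
  set good := {J : Interaction n (2 * m) → ℝ | ∀ x, |interactionForm J x| ≤ 2 * t * ∏ a, ‖x a‖}
  let bad : (Fin m → UpperMatrix (2 * n)) → Set (Interaction n (2 * m) → ℝ) :=
    fun y => {J | t ≤ |∑ I, J I * polarPfaffian m (Interaction.enum I) y|}
  let T := Fintype.piFinset fun _ : Fin m => S
  -- Covering the whole space needs only monotonicity and subadditivity, so measurability of `good`
  -- is not required.
  have hcover : Set.univ ⊆ good ∪ ⋃ y ∈ T, bad y := by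
    intro J _
    by_contra h
    simp only [Set.mem_union, Set.mem_iUnion, not_or, not_exists] at h
    refine h.1 fun x => multilinear_le_of_net (interactionForm J) (S := S) hball hnet ht
      (fun y hy => ?_) x
    have h2 := h.2 y (Fintype.mem_piFinset.2 hy)
    rw [interactionForm_apply]
    exact (not_le.1 h2).le
  have hbad : ∀ y ∈ T, μ.real (bad y) ≤ 2 * Real.exp (-t ^ 2 / (2 * ((2 * m - 1)‼ : ℝ) ^ 2)) := by
    intro y hy
    have hy1 : ∏ a, ‖y a‖ ^ 2 ≤ 1 := Finset.prod_le_one (fun _ _ => by positivity) fun a _ =>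
      pow_le_one₀ (norm_nonneg _) (hball _ (Fintype.mem_piFinset.1 hy a))
    refine gaussian_tail _ (by positivity) ht ((sum_polarPfaffian_enum_sq_le y).trans ?_)
    exact mul_le_of_le_one_right (by positivity) hy1
  have h1 : (1 : ℝ) ≤ μ.real good + ∑ y ∈ T, μ.real (bad y) := by
    calc (1 : ℝ) = μ.real Set.univ := by simp
      _ ≤ μ.real (good ∪ ⋃ y ∈ T, bad y) := measureReal_mono hcover
      _ ≤ μ.real good + μ.real (⋃ y ∈ T, bad y) := measureReal_union_le _ _
      _ ≤ _ := by gcongr; exact measureReal_biUnion_finset_le _ _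
  have h2 := Finset.sum_le_card_nsmul T _ _ hbad
  have h3 : (T.card : ℝ) ≤ ((3 * 2 ^ (2 * m) : ℝ) ^ Fintype.card (UpperPair (2 * n))) ^ m := by
    have : T.card = S.card ^ m := by simp [T]
    rw [this]; push_cast
    gcongr
  rw [nsmul_eq_mul] at h2
  have h4 := mul_le_mul_of_nonneg_right h3
    (by positivity : 0 ≤ 2 * Real.exp (-t ^ 2 / (2 * ((2 * m - 1)‼ : ℝ) ^ 2)))
  linarith

/-! ### Numerical estimates and conclusion -/

theorem card_upperPair_le (n : ℕ) : Fintype.card (UpperPair (2 * n)) ≤ 2 * n ^ 2 := by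
  let f : UpperPair (2 * n) ⊕ UpperPair (2 * n) → Fin (2 * n) × Fin (2 * n) :=
    Sum.elim (fun p => p.1) (fun p => p.1.swap)
  have hf : Function.Injective f := by
    rintro (⟨⟨a, b⟩, h⟩ | ⟨⟨a, b⟩, h⟩) (⟨⟨a', b'⟩, h'⟩ | ⟨⟨a', b'⟩, h'⟩) hab <;>
      simp only [f, Sum.elim_inl, Sum.elim_inr, Prod.swap, Prod.mk.injEq] at hab <;>
      obtain ⟨rfl, rfl⟩ := hab
    · rfl
    · exact absurd h h'.not_gt
    · exact absurd h h'.not_gt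
    · rfl
  have := Fintype.card_le_of_injective f hf
  simp only [Fintype.card_sum, Fintype.card_prod, Fintype.card_fin] at this
  nlinarith

/-- The induction uses (1 + 1/q)^q ≥ 2. The inequality fails at q = 3. -/
theorem two_mul_self_mul_factorial_le {q : ℕ} (hq : 4 ≤ q) : 2 * q * q ! ≤ q ^ q := by
  induction q, hq using Nat.le_induction with
  | base => decide
  | succ q hq ih =>
    have h1 : 2 * q ^ q ≤ (q + 1) ^ q := by
      have hq0 : (0 : ℝ) < q := by exact_mod_cast (by omega : 0 < q)
      have h2 := one_add_mul_le_pow (a := (1 / q : ℝ))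
        (by have : (0 : ℝ) < 1 / q := by positivity
            linarith) q
      rw [mul_one_div_cancel hq0.ne'] at h2
      have h3 := mul_le_mul_of_nonneg_right h2 (pow_nonneg hq0.le q)
      rw [one_add_one_eq_two, ← mul_pow, add_mul, one_div_mul_cancel hq0.ne', one_mul] at h3
      exact_mod_cast h3
    have h2 : 2 * (q + 1) * q ! ≤ (q + 1) ^ q := by
      nlinarith [Nat.factorial_pos q, Nat.mul_le_mul_right q ! hq]
    rw [Nat.factorial_succ, pow_succ]
    nlinarith

/-- Bernoulli: (1 - q/N)^q ≥ 1 - q²/N ≥ 1/2. -/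
theorem pow_div_two_mul_factorial_le_choose {N q : ℕ} (hq : 0 < q) (hN : 2 * q ^ 2 ≤ N) :
    (N : ℝ) ^ q / (2 * q !) ≤ N.choose q := by
  refine le_trans ?_ (Nat.pow_le_choose q N)
  have hqN : q ≤ N + 1 := by nlinarith
  have hN0 : (0 : ℝ) < N := by
    have : 0 < N := by nlinarith
    exact_mod_cast this
  have hq0 : (0 : ℝ) < q := by exact_mod_cast hq
  have hNr : 2 * (q : ℝ) ^ 2 ≤ N := by exact_mod_cast hN
  have h1 : (1 : ℝ) / 2 ≤ (1 + -(q / N : ℝ)) ^ q := by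
    have hqN1 : (q : ℝ) / N ≤ 1 / 2 := by
      rw [div_le_div_iff₀ hN0 two_pos]
      have : (1 : ℝ) ≤ q := by exact_mod_cast hq
      nlinarith
    refine le_trans ?_ (one_add_mul_le_pow (by linarith) q)
    have : (q : ℝ) * (q / N) ≤ 1 / 2 := by
      rw [← mul_div_assoc, div_le_div_iff₀ hN0 two_pos]; nlinarith
    linarith
  have h2 : (N : ℝ) ^ q / 2 ≤ ((N + 1 - q : ℕ) : ℝ) ^ q := by
    calc (N : ℝ) ^ q / 2 = N ^ q * (1 / 2) := by ring
      _ ≤ N ^ q * (1 + -(q / N : ℝ)) ^ q := by gcongr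
      _ = (N - q) ^ q := by rw [← mul_pow]; congr 1; field_simp; ring
      _ ≤ _ := by
        rw [Nat.cast_sub hqN]
        have : (q : ℝ) ≤ N := by nlinarith [(by exact_mod_cast hq : (1 : ℝ) ≤ q)]
        gcongr
        linarith
  rw [← div_div]
  gcongr

/-- From log(3/2) ≤ 1/2 the argument is at least 8 > e². Only this constant lower bound on the
logarithmic factor enters the tail estimate. -/
theorem two_le_log_div_log {q : ℕ} (hq : 4 ≤ q) : 2 ≤ Real.log (q / Real.log (3 / 2)) := by
  have hl0 : 0 < Real.log (3 / 2) := Real.log_pos (by norm_num)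
  have hl1 : Real.log (3 / 2) ≤ 1 / 2 := by
    have := Real.log_le_sub_one_of_pos (x := 3 / 2) (by norm_num)
    linarith
  have hq4 : (4 : ℝ) ≤ q := by exact_mod_cast hq
  have h8 : 8 ≤ q / Real.log (3 / 2) := by
    rw [le_div_iff₀ hl0]; linarith
  rw [Real.le_log_iff_exp_le (by linarith)]
  refine le_trans ?_ h8
  have := Real.exp_one_lt_d9
  rw [show (2 : ℝ) = 1 + 1 by norm_num, Real.exp_add]
  nlinarith [Real.exp_pos 1]

theorem three_mul_two_pow_le_exp {q : ℕ} (hq : 4 ≤ q) : (3 * 2 ^ q : ℝ) ≤ Real.exp q := by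
  have h1 := Real.exp_one_gt_d9
  induction q, hq using Nat.le_induction with
  | base =>
    rw [show ((4 : ℕ) : ℝ) = (4 : ℕ) * 1 by norm_num, Real.exp_nat_mul]
    calc (3 * 2 ^ 4 : ℝ) ≤ 2.7 ^ 4 := by norm_num
      _ ≤ _ := by gcongr; linarith
  | succ q hq ih =>
    push_cast
    rw [Real.exp_add, pow_succ]
    nlinarith [Real.exp_pos q]

/-- A bound for all thermal states extends to all Gaussian states. -/
theorem norm_trace_mul_le_of_isGaussianState {c : Fin (2 * n) → FockOp n} {H ρ : FockOp n}
    {B : ℝ} (h : ∀ β : Matrix (Fin (2 * n)) (Fin (2 * n)) ℝ, β.transpose = -β →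
      ‖(H * thermalState c β).trace‖ ≤ B) (hρ : IsGaussianState c ρ) : ‖(H * ρ).trace‖ ≤ B := by
  have hclosed : IsClosed {ρ : FockOp n | ‖(H * ρ).trace‖ ≤ B} :=
    isClosed_le (by fun_prop) continuous_const
  refine closure_minimal ?_ hclosed hρ
  rintro _ ⟨β, hβ, rfl⟩
  exact h β hβ

theorem IsMajorana.norm_trace_hamiltonian_mul_le {c : Fin (2 * n) → FockOp n}
    (hc : IsMajorana c) {J : Interaction n (2 * m) → ℝ} {t : ℝ} (ht : 0 ≤ t)
    (hJ : ∀ x, |interactionForm J x| ≤ 2 * t * ∏ a, ‖x a‖) {ρ : FockOp n}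
    (hρ : IsGaussianState c ρ) :
    ‖(hamiltonian c J * ρ).trace‖ ≤ (√((2 * n).choose (2 * m) : ℝ))⁻¹ * (2 * t * √n ^ m) := by
  refine norm_trace_mul_le_of_isGaussianState (fun β hβ => ?_) hρ
  have hG : ‖covarianceMatrix c (thermalState c β)‖ ≤ √n :=
    Real.le_sqrt_of_sq_le (hc.norm_covarianceMatrix_sq_le
      (hc.posDef_thermalState β).posSemidef (hc.trace_thermalState β))
  rw [hc.trace_hamiltonian_mul_thermalState hβ, Complex.norm_real, norm_mul,
    Real.norm_of_nonneg (by positivity : 0 ≤ (√((2 * n).choose (2 * m) : ℝ))⁻¹), Real.norm_eq_abs]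
  refine mul_le_mul_of_nonneg_left ((hJ _).trans ?_) (by positivity)
  rw [Finset.prod_const, Finset.card_univ, Fintype.card_fin]
  gcongr

/-- With at most 2n² dimensions and e^(2m) points per dimension, the m-tuples of net points number
at most exp(4m²n²), half the tail exponent. The other half absorbs the factor 2 and leaves e^(-n).
-/
theorem net_mul_tail_le {n m : ℕ} (hn : 0 < n) (hm : 2 ≤ m) {s : ℝ}
    (hs : 8 * m ^ 2 * n ^ 2 ≤ s) :
    ((3 * 2 ^ (2 * m) : ℝ) ^ Fintype.card (UpperPair (2 * n))) ^ m * (2 * Real.exp (-s))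
      ≤ Real.exp (-(1 * n)) := by
  have hm2 : (2 : ℝ) ≤ m := by exact_mod_cast hm
  have hn1 : (1 : ℝ) ≤ n := by exact_mod_cast hn
  have hD : (Fintype.card (UpperPair (2 * n)) : ℝ) ≤ 2 * n ^ 2 := by
    exact_mod_cast card_upperPair_le n
  have h1 : ((3 * 2 ^ (2 * m) : ℝ) ^ Fintype.card (UpperPair (2 * n))) ^ m
      ≤ Real.exp (4 * m ^ 2 * n ^ 2) := by
    calc _ ≤ (Real.exp (2 * m : ℕ) ^ Fintype.card (UpperPair (2 * n))) ^ m := by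
          gcongr; exact three_mul_two_pow_le_exp (by omega)
      _ = Real.exp (m * (Fintype.card (UpperPair (2 * n)) * (2 * m))) := by
          rw [← Real.exp_nat_mul, ← Real.exp_nat_mul]; push_cast; rfl
      _ ≤ _ := by
          rw [Real.exp_le_exp]
          calc (m : ℝ) * (Fintype.card (UpperPair (2 * n)) * (2 * m))
              ≤ m * ((2 * n ^ 2) * (2 * m)) := by gcongr
            _ = _ := by ring
  have h2 : (2 : ℝ) ≤ Real.exp 1 := by linarith [Real.exp_one_gt_d9]
  calc _ ≤ Real.exp (4 * m ^ 2 * n ^ 2) * (Real.exp 1 * Real.exp (-s)) := by gcongr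
    _ = Real.exp (4 * m ^ 2 * n ^ 2 + (1 + -s)) := by rw [Real.exp_add, Real.exp_add]
    _ ≤ _ := by
      rw [Real.exp_le_exp]
      have h3 : (4 : ℝ) ≤ m ^ 2 := by nlinarith
      have h4 : (n : ℝ) ≤ n ^ 2 := by nlinarith
      have h5 : 4 * (n : ℝ) ≤ m ^ 2 * n ^ 2 := by gcongr
      nlinarith

/-- The bound on the energy of Gaussian states, for `q = 2 m`. -/
def energyBound (q n : ℕ) : ℝ :=
  ((q - 1)‼ : ℝ) * (2 : ℝ) ^ ((1 : ℝ) / 2 - (q : ℝ) / 4) * (q : ℝ) ^ ((1 : ℝ) / 2 + (q : ℝ) / 2)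
    * √(Real.log ((q : ℝ) / Real.log (3 / 2))) * (2 * (n : ℝ)) ^ (1 - (q : ℝ) / 4)

theorem energyBound_nonneg (q n : ℕ) : 0 ≤ energyBound q n := by
  rw [energyBound]; positivity

theorem rpow_sq_mul_pow {b e : ℝ} (hb : 0 < b) (m k : ℕ) (h : 2 * e + m = k) :
    (b ^ e) ^ 2 * b ^ m = b ^ k := by
  rw [← Real.rpow_natCast (b ^ e), ← Real.rpow_mul hb.le, ← Real.rpow_natCast b m,
    ← Real.rpow_add hb, ← Real.rpow_natCast b k, ← h]
  congr 1
  push_cast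
  ring

/-- Squaring and multiplying by (2n)^(2m), the leading power in the binomial, clears all fractional
exponents. -/
theorem energyBound_sq_mul {n m : ℕ} (hn : 0 < n) (hm : 2 ≤ m) :
    energyBound (2 * m) n ^ 2 * ((2 * n : ℝ) ^ (2 * m)) =
      2 * ((2 * m - 1)‼ : ℝ) ^ 2 * (2 * m : ℝ) ^ (2 * m + 1)
        * Real.log ((2 * m : ℕ) / Real.log (3 / 2)) * (2 * n) ^ 2 * n ^ m := by
  have hn0 : (0 : ℝ) < n := by exact_mod_cast hn
  have hm0 : (0 : ℝ) < m := by exact_mod_cast (by omega : 0 < m)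
  have hA := rpow_sq_mul_pow (b := 2) (e := (1 : ℝ) / 2 - ((2 * m : ℕ) : ℝ) / 4) two_pos m 1
    (by push_cast; ring)
  have hB := rpow_sq_mul_pow (b := (2 * m : ℕ)) (e := (1 : ℝ) / 2 + ((2 * m : ℕ) : ℝ) / 2)
    (by push_cast; positivity) 0 (2 * m + 1) (by push_cast; ring)
  have hC := rpow_sq_mul_pow (b := 2 * n) (e := 1 - ((2 * m : ℕ) : ℝ) / 4)
    (by positivity) m 2 (by push_cast; ring)
  have hL := Real.sq_sqrt (zero_le_two.trans (two_le_log_div_log (q := 2 * m) (by omega)))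
  rw [pow_zero, mul_one] at hB
  rw [energyBound, mul_pow, mul_pow, mul_pow, mul_pow, hB, hL]
  generalize (2 : ℝ) ^ ((1 : ℝ) / 2 - ((2 * m : ℕ) : ℝ) / 4) = A at hA ⊢
  generalize (2 * n : ℝ) ^ (1 - ((2 * m : ℕ) : ℝ) / 4) = C at hC ⊢
  generalize Real.log (((2 * m : ℕ) : ℝ) / Real.log (3 / 2)) = L
  have hsplit : ((2 : ℝ) * n) ^ (2 * m) = (2 * n) ^ m * (2 ^ m * n ^ m) := by
    rw [← mul_pow 2 (n : ℝ), ← pow_add, two_mul m]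
  rw [hsplit, Nat.cast_mul, Nat.cast_ofNat]
  linear_combination (((2 * m - 1)‼ : ℝ) ^ 2 * (2 * m : ℝ) ^ (2 * m + 1) * L * n ^ m) *
    (C ^ 2 * (2 * n) ^ m * hA + 2 * hC)

/-- The double factorials cancel; the (2m)! from the binomial is absorbed by the power of q in the
bound, and the logarithm is replaced by 2. -/
theorem exponent_lower_bound {n m : ℕ} (hm : 2 ≤ m) (hn : (2 * m) ^ 2 ≤ n) :
    8 * (m : ℝ) ^ 2 * n ^ 2 ≤ (energyBound (2 * m) n * √((2 * n).choose (2 * m) : ℝ)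
      / (2 * √n ^ m)) ^ 2 / (2 * ((2 * m - 1)‼ : ℝ) ^ 2) := by
  have hn0' : 0 < n := by nlinarith
  have hn0 : (0 : ℝ) < n := by exact_mod_cast hn0'
  have hm0 : (0 : ℝ) < m := by exact_mod_cast (by omega : 0 < m)
  have hC := pow_div_two_mul_factorial_le_choose (N := 2 * n) (q := 2 * m) (by omega) (by omega)
  have hL := two_le_log_div_log (q := 2 * m) (by omega)
  have hfac : (2 * (2 * m : ℕ) * (2 * m)! : ℝ) ≤ ((2 * m : ℕ) : ℝ) ^ (2 * m) := by
    exact_mod_cast two_mul_self_mul_factorial_le (q := 2 * m) (by omega)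
  have hT := energyBound_sq_mul hn0' hm
  have hdd : (0 : ℝ) < ((2 * m - 1)‼ : ℝ) := by exact_mod_cast Nat.doubleFactorial_pos _
  have hf : (0 : ℝ) < ((2 * m)! : ℝ) := by exact_mod_cast Nat.factorial_pos _
  set L := Real.log ((2 * m : ℕ) / Real.log (3 / 2))
  have hsn : (√(n : ℝ) ^ m) ^ 2 = n ^ m := by
    rw [← pow_mul, mul_comm, pow_mul, Real.sq_sqrt hn0.le]
  push_cast at hC hfac
  rw [div_pow, mul_pow, Real.sq_sqrt (by positivity), mul_pow, hsn]
  rw [le_div_iff₀ (by positivity), le_div_iff₀ (by positivity)]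
  calc 8 * (m : ℝ) ^ 2 * n ^ 2 * (2 * ((2 * m - 1)‼ : ℝ) ^ 2) * (2 ^ 2 * n ^ m)
      = (((2 * m - 1)‼ : ℝ) ^ 2 * (2 * m) * 2 * (2 * n) ^ 2 * n ^ m / (2 * m)!)
          * (2 * (2 * m) * (2 * m)!) := by
        field_simp; ring
    _ ≤ (((2 * m - 1)‼ : ℝ) ^ 2 * (2 * m) * L * (2 * n) ^ 2 * n ^ m / (2 * m)!)
          * (2 * m) ^ (2 * m) := by gcongr
    _ = (2 * ((2 * m - 1)‼ : ℝ) ^ 2 * (2 * m : ℝ) ^ (2 * m + 1) * L * (2 * n) ^ 2 * n ^ m)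
          / (2 * (2 * m)!) := by field_simp; ring
    _ = energyBound (2 * m) n ^ 2 * ((2 * n : ℝ) ^ (2 * m) / (2 * (2 * m)!)) := by
        rw [← hT, mul_div_assoc]
    _ ≤ _ := by gcongr

end SYK

end

theorem mainTheorem5 (q : ℕ) (hq : 4 ≤ q) (hq_even : Even q) :
    ∃ κ : ℝ, 0 < κ ∧ ∃ n₀ : ℕ, ∀ n : ℕ, n₀ ≤ n →
      ∀ c : Fin (2 * n) → SYK.FockOp n, SYK.IsMajorana c →
        1 - Real.exp (-(κ * n)) ≤
          (SYK.couplingLaw n q).real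
            {J | ∀ ρ : SYK.FockOp n, SYK.IsGaussianState c ρ →
              ‖(SYK.hamiltonian c J * ρ).trace‖ ≤
                ((q - 1)‼ : ℝ) * (2 : ℝ) ^ ((1 : ℝ) / 2 - (q : ℝ) / 4)
                  * (q : ℝ) ^ ((1 : ℝ) / 2 + (q : ℝ) / 2)
                  * √(Real.log ((q : ℝ) / Real.log (3 / 2)))
                  * (2 * (n : ℝ)) ^ (1 - (q : ℝ) / 4)} := by
  obtain ⟨m, rfl⟩ := hq_even.two_dvd
  -- n ≥ q² is what the binomial estimate with N = 2n requires.
  refine ⟨1, one_pos, (2 * m) ^ 2, fun n hn c hc => ?_⟩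
  have hm : 2 ≤ m := by omega
  have hn0 : 0 < n := by nlinarith
  have hn0' : (0 : ℝ) < n := by exact_mod_cast hn0
  have hchoose : (0 : ℝ) < (2 * n).choose (2 * m) := by
    exact_mod_cast Nat.choose_pos (by nlinarith)
  -- Chosen so that the energy bound 2t √n^m / √binom(2n,q) equals the claimed one exactly.
  set t : ℝ := SYK.energyBound (2 * m) n * √((2 * n).choose (2 * m) : ℝ) / (2 * √n ^ m) with ht
  have ht0 : 0 ≤ t := by
    have := SYK.energyBound_nonneg (2 * m) n
    positivity
  have hprob := SYK.one_sub_le_couplingLaw_real_interactionForm hn0 (by omega : 0 < m) ht0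
  have htail := SYK.net_mul_tail_le hn0 hm (SYK.exponent_lower_bound hm hn)
  rw [← ht, ← neg_div] at htail
  have : MeasureTheory.IsProbabilityMeasure (SYK.couplingLaw n (2 * m)) := by
    rw [SYK.couplingLaw]; infer_instance
  refine (by linarith : 1 - Real.exp (-(1 * n)) ≤ _).trans
    (hprob.trans (MeasureTheory.measureReal_mono fun J hJ ρ hρ => ?_))
  refine (hc.norm_trace_hamiltonian_mul_le ht0 hJ hρ).trans (le_of_eq ?_)
  change _ = SYK.energyBound (2 * m) n
  have h1 : √((2 * n).choose (2 * m) : ℝ) ≠ 0 := (Real.sqrt_pos.2 hchoose).ne'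
  have h2 : √(n : ℝ) ^ m ≠ 0 := (pow_pos (Real.sqrt_pos.2 hn0') m).ne'
  rw [ht]
  field_simp
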